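/- Consider $n$ nodes, node $v$ holding a value $x_v$ from a totally ordered set. For a nonempty finite multiset $S$ of values let $Q_S(z)$ be the fraction of elements of $S$ that are smaller than $z$, and let $Q(z)$ be the fraction of nodes $v$ with $x_v<z$. The doubling algorithm with compaction and buffer size $k$ works as follows. Before the first round every node $v$ samples a node $t_0(v)$ and sets its buffer to $\tilde S_v=\{x_{t_0(v)}\}$. In each round $i=1,\dots,T$ every node $v$ contacts a node $t_i(v)$, and all nodes simultaneously update $\tilde S_v\leftarrow \mathrm{Compact}(\tilde S_v\cup\tilde S_{t_i(v)})$ (multiset union, multiplicities added). Here $\mathrm{Compact}(Z)=Z$ if $|Z|\le k$; otherwise $\mathrm{Compact}(Z)$ consists of the elements in the even positions (2nd, 4th, ...) of $Z$ sorted in non-decreasing order. All $t_i(v)$, $0\le i\le T$, are independent and uniform over the $n$ nodes. **Theorem.** Let $\varepsilon=\Omega(n^{-1/16})$, $\varepsilon<1$, and run this algorithm with buffer size $k=\Theta\bigl(\frac1\varepsilon(\log\log n+\log\frac1\varepsilon)\bigr)$ for $T=\Theta(\log\log n+\log\frac1\varepsilon)$ rounds, with sufficiently large hidden constants. Then, for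 any given $z$, with high probability $|Q(z)-Q_{\tilde S_v}(z)|\le\varepsilon$ for every node $v$. Precisely, with $\log$ the natural logarithm: for every $c>0$ there is $A>0$ such that for every $C>0$ there is $B_1>0$ such that for all $B_2\ge B_1$ and $c_0>0$ there is $n_0$ with the following property. Let $n\ge n_0$, $c_0n^{-1/16}\le\varepsilon<1$, and let $T,k$ be natural numbers with $$2^T\ge \frac{A\log n}{\varepsilon^2},\qquad T\le C\Bigl(\log\log n+\log\frac1\varepsilon\Bigr),\qquad \frac{B_1}{\varepsilon}\Bigl(\log\log n+\log\frac1\varepsilon\Bigr)\le k\le \frac{B_2}{\varepsilon}\Bigl(\log\log n+\log\frac1\varepsilon\Bigr).$$ Then for all values $(x_v)_v$ and every $z$, with probability at least $1-n^{-c}$, every node $v$ satisfies $|Q(z)-Q_{\tilde S_v}(z)|\le\varepsilon$, and the same inequality also holds when "smaller than $z$" is replaced by "smaller than or equal to $z$" in the definitions of $Q$ and $Q_S$. (The first condition on $T$ reads $T\ge\log_2\log n+2\log_2\frac1\varepsilon+\log_2 A$; it says that without compaction the buffers would hold $2^T\ge A\log n/\varepsilon^2$ values. For large $n$ every $T\ge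 3(\log_2\log_2 n+\log_2\frac1\varepsilon)$ satisfies it.) -/

import Mathlib

namespace Gossip

/-- The entries of a list in its even positions (the 2nd, 4th, 6th, …, counting from 1). -/
def evenPositions {α : Type*} : List α → List α
  | _ :: b :: l => b :: evenPositions l
  | _ => []

/-- The compaction operation with buffer size `k`: a multiset with at most `k` elements is left
unchanged; otherwise its elements are sorted in non-decreasing order and those in the even
positions are extracted. -/
def compact {α : Type*} [LinearOrder α] (k : ℕ) (Z : Multiset α) : Multiset α :=
  if Z.card ≤ k then Z else (evenPositions (Z.sort (· ≤ ·)) : Multiset α)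

/-- The compacted buffers of the doubling algorithm after `T` rounds, when node `v` has value
`x v`, `t 0 v` is the node that `v` samples before the first round, and `t i v` is the node that
`v` contacts in round `i` for `1 ≤ i ≤ T`.  Initially the buffer of `v` holds the value of the
sampled node.  In each round all nodes simultaneously replace their buffer by the compaction of the
multiset sum of their buffer and the buffer of the contacted node. -/
def buffer {α : Type*} [LinearOrder α] {n : ℕ} (k : ℕ) (x : Fin n → α) :
    (T : ℕ) → (t : Fin (T + 1) → Fin n → Fin n) → Fin n → Multiset α
  | 0, t, v => {x (t 0 v)}
  | T + 1, t, v =>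
      compact k (buffer k x T (Fin.init t) v +
        buffer k x T (Fin.init t) (t (Fin.last (T + 1)) v))

/-- The quantile of `z` in the multiset `S`: the fraction of elements of `S` smaller than `z`. -/
noncomputable def quantileLT {α : Type*} [LinearOrder α] (S : Multiset α) (z : α) : ℝ :=
  (S.countP (· < z) : ℝ) / S.card

/-- The quantile of `z` in the multiset `S`, in the convention where elements equal to `z`
count too. -/
noncomputable def quantileLE {α : Type*} [LinearOrder α] (S : Multiset α) (z : α) : ℝ :=
  (S.countP (· ≤ z) : ℝ) / S.card

/-- The multiset of the values of all nodes. -/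
def allValues {α : Type*} {n : ℕ} (x : Fin n → α) : Multiset α :=
  Finset.univ.val.map x

/-- The joint law of the contacts `t i v`, `0 ≤ i ≤ T`, `v` a node: the uniform distribution on
all families of contacts.  Equivalently, the contacts are independent and each is uniformly
distributed over the `n` nodes. -/
noncomputable def contactLaw (n T : ℕ) :
    MeasureTheory.Measure (Fin (T + 1) → Fin n → Fin n) :=
  ProbabilityTheory.uniformOn Set.univ

/-- The quantity `log log n + log (1 / ε)`. -/
noncomputable def logScale (n : ℕ) (ε : ℝ) : ℝ :=
  Real.log (Real.log n) + Real.log (1 / ε)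

end Gossip

namespace Gossip

open scoped BigOperators

/-! Two errors are bounded separately, each by `ε / 2`. Compaction is a deterministic error. All
buffers of a round have the same size, so an uncompacted merge averages two fractions exactly, and
compaction shifts the result by at most `1 / k`. Averaging does not amplify inherited errors, so `T`
rounds cost at most `T / k` (`abs_fraction_buffer_sub_average_le`). Sampling is the random error.
Traced backwards from node `v`, the `average` is a weighted sum of the initial samples. The weights
start as a point mass at `v`, and each round sends half of every weight to a random node. The
support at most doubles, and the largest weight halves except where pieces of weight meet. With at
most `m` collisions in all, every final weight is at most `2 ^ m / 2 ^ T`, and a Chernoff bound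
applies (`prob_le_sum_mul_le`). Having more than `m` collisions is unlikely, by an exponential
moment with base `β` (`expect_pow_collisions_le_exp`). One induction over the rounds combines both
(`prob_le_sum_mul_average_le`). The collision bound needs `4 ^ T` small compared with `n`. It is
therefore used only at the first `T₀` at which `2 ^ T₀` is large enough; later rounds cannot push
the averages out of an interval that contains them all. -/

/-! ### Deterministic error of compaction -/

theorem length_evenPositions {α : Type*} : ∀ l : List α, (evenPositions l).length = l.length / 2
  | [] => by simp [evenPositions]
  | [_] => by simp [evenPositions]
  | _ :: _ :: l => by
      simp only [evenPositions, List.length_cons, length_evenPositions l]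
      omega

/-- A downward closed `p` holds on a prefix of a sorted list, and every second entry of that prefix
is kept. -/
theorem countP_evenPositions {α : Type*} [LinearOrder α] (p : α → Prop) [DecidablePred p]
    (hp : ∀ a b, a ≤ b → p b → p a) :
    ∀ l : List α, l.Pairwise (· ≤ ·) → (evenPositions l).countP p = l.countP p / 2
  | [], _ => by simp [evenPositions]
  | [a], _ => by by_cases h : p a <;> simp [evenPositions, h]
  | a :: b :: l, h => by
      have ha := (List.pairwise_cons.1 h)
      have hb := (List.pairwise_cons.1 ha.2)
      have ih := countP_evenPositions p hp l hb.2
      have hab : a ≤ b := ha.1 b (by simp)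
      by_cases h2 : p b
      · have h1 := hp a b hab h2
        simp [evenPositions, h1, h2, ih]
        omega
      · have hl : l.countP p = 0 := by
          rw [List.countP_eq_zero]
          intro y hy
          simpa using fun hpy => h2 (hp b y (hb.1 y hy) hpy)
        by_cases h1 : p a <;> simp [evenPositions, h1, h2, ih, hl]

theorem card_compact {α : Type*} [LinearOrder α] (k : ℕ) (Z : Multiset α) :
    (compact k Z).card = if Z.card ≤ k then Z.card else Z.card / 2 := by
  unfold compact
  split_ifs
  · rfl
  · simp [length_evenPositions]

theorem countP_compact {α : Type*} [LinearOrder α] (k : ℕ) (Z : Multiset α)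
    (p : α → Prop) [DecidablePred p] (hp : ∀ a b, a ≤ b → p b → p a) :
    (compact k Z).countP p = if Z.card ≤ k then Z.countP p else Z.countP p / 2 := by
  unfold compact
  split_ifs
  · rfl
  · rw [Multiset.coe_countP, countP_evenPositions p hp _ (Multiset.pairwise_sort Z (· ≤ ·)),
      ← Multiset.coe_countP, Multiset.sort_eq]

/-- The fraction of elements of `S` that satisfy `p`. -/
noncomputable def fraction {α : Type*} (p : α → Prop) [DecidablePred p] (S : Multiset α) : ℝ :=
  (S.countP p : ℝ) / S.card

/-- Rounding the halved count down costs at most half an element out of `s`, and compaction happens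
only if `2 * s > k`. -/
theorem abs_fraction_compact_sub_le {α : Type*} [LinearOrder α] {k s : ℕ} (hk : 0 < k)
    (hs : 0 < s) (p : α → Prop) [DecidablePred p] (hp : ∀ a b, a ≤ b → p b → p a)
    {Y Z : Multiset α} (hY : Y.card = s) (hZ : Z.card = s) :
    |fraction p (compact k (Y + Z)) - (fraction p Y + fraction p Z) / 2| ≤ 1 / k := by
  have hs' : (0 : ℝ) < s := by exact_mod_cast hs
  have hk' : (0 : ℝ) < k := by exact_mod_cast hk
  unfold fraction
  rw [card_compact, countP_compact k _ p hp, Multiset.card_add, Multiset.countP_add, hY, hZ]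
  split_ifs with h
  · have : ((Y.countP p + Z.countP p : ℕ) : ℝ) / ((s + s : ℕ) : ℝ)
        - ((Y.countP p : ℝ) / s + (Z.countP p : ℝ) / s) / 2 = 0 := by
      push_cast
      field_simp
      ring
    rw [this, abs_zero]
    positivity
  · have h2 : (s + s) / 2 = s := by omega
    rw [h2]
    set a := Y.countP p
    set b := Z.countP p
    have e1 : 2 * ((a + b) / 2) ≤ a + b := by omega
    have e2 : a + b ≤ 2 * ((a + b) / 2) + 1 := by omega
    have e1' : 2 * (((a + b) / 2 : ℕ) : ℝ) ≤ a + b := by exact_mod_cast e1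
    have e2' : (a + b : ℝ) ≤ 2 * (((a + b) / 2 : ℕ) : ℝ) + 1 := by exact_mod_cast e2
    have h3 : (k : ℝ) ≤ 2 * s := by
      have : k ≤ 2 * s := by omega
      exact_mod_cast this
    have : (((a + b) / 2 : ℕ) : ℝ) / s - ((a : ℝ) / s + (b : ℝ) / s) / 2
        = (2 * (((a + b) / 2 : ℕ) : ℝ) - (a + b)) / (2 * s) := by
      field_simp
    rw [this, abs_div, abs_of_pos (by positivity : (0 : ℝ) < 2 * s)]
    apply div_le_div₀ zero_le_one _ hk' h3
    rw [abs_le]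
    constructor <;> linarith

/-- Sizes evolve independently of the contacts, so the two merged buffers always carry equal weight.
-/
theorem exists_card_buffer {α : Type*} [LinearOrder α] {n : ℕ} (k : ℕ) (x : Fin n → α) (T : ℕ) :
    ∃ s, 0 < s ∧ ∀ t v, (buffer k x T t v).card = s := by
  induction T with
  | zero => exact ⟨1, one_pos, fun t v => by simp [buffer]⟩
  | succ T ih =>
    obtain ⟨s, hs, h⟩ := ih
    refine ⟨if s + s ≤ k then s + s else (s + s) / 2, by split_ifs <;> omega, fun t v => ?_⟩
    rw [buffer, card_compact, Multiset.card_add, h, h]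

/-- The averages that the doubling algorithm computes without compaction, when a sampled node `u`
contributes `g u`. -/
noncomputable def average {n : ℕ} (g : Fin n → ℝ) :
    (T : ℕ) → (t : Fin (T + 1) → Fin n → Fin n) → Fin n → ℝ
  | 0, t, v => g (t 0 v)
  | T + 1, t, v =>
      (average g T (Fin.init t) v + average g T (Fin.init t) (t (Fin.last (T + 1)) v)) / 2

theorem abs_fraction_buffer_sub_average_le {α : Type*} [LinearOrder α] {n k : ℕ} (hk : 0 < k)
    (x : Fin n → α) (p : α → Prop) [DecidablePred p] (hp : ∀ a b, a ≤ b → p b → p a) (T : ℕ) :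
    ∀ t v, |fraction p (buffer k x T t v) -
      average (fun u => if p (x u) then 1 else 0) T t v| ≤ T / k := by
  induction T with
  | zero =>
    intro t v
    have hc : Multiset.countP p {x (t 0 v)} = if p (x (t 0 v)) then 1 else 0 := by
      rw [← Multiset.cons_zero, Multiset.countP_cons]
      simp
    by_cases h : p (x (t 0 v)) <;> simp [buffer, average, fraction, h, hc]
  | succ T ih =>
    intro t v
    obtain ⟨s, hs, hc⟩ := exists_card_buffer k x T
    have h0 := abs_fraction_compact_sub_le hk hs p hp (hc (Fin.init t) v)
      (hc (Fin.init t) (t (Fin.last (T + 1)) v))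
    have h1 := ih (Fin.init t) v
    have h2 := ih (Fin.init t) (t (Fin.last (T + 1)) v)
    rw [buffer, average]
    push_cast
    rw [add_div _ 1 (k : ℝ)]
    rw [abs_le] at h0 h1 h2 ⊢
    constructor <;> linarith

theorem average_sub_const {n : ℕ} (g : Fin n → ℝ) (q : ℝ) (T : ℕ) :
    ∀ t v, average (fun u => g u - q) T t v = average g T t v - q := by
  induction T with
  | zero => intro t v; rfl
  | succ T ih => intro t v; rw [average, average, ih, ih]; ring

theorem average_neg {n : ℕ} (g : Fin n → ℝ) (T : ℕ) :
    ∀ t v, average (fun u => - g u) T t v = - average g T t v := by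
  induction T with
  | zero => intro t v; rfl
  | succ T ih => intro t v; rw [average, average, ih, ih]; ring

theorem fraction_allValues {α : Type*} {n : ℕ} (x : Fin n → α) (p : α → Prop) [DecidablePred p] :
    fraction p (allValues x) = (∑ u, if p (x u) then 1 else 0) / n := by
  rw [fraction, allValues, Multiset.countP_map, Multiset.card_map, Finset.sum_boole]
  rw [show Multiset.card (Finset.univ : Finset (Fin n)).val = n from Finset.card_fin n]
  rfl

/-! ### Backward weights and collisions -/

/-- The total weight that each node receives, one round earlier, when every node passes half of its
weight to the node that it contacts. -/
noncomputable def pullback {n : ℕ} (τ : Fin n → Fin n) (w : Fin n → ℝ) (u : Fin n) : ℝ :=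
  (w u + ∑ v with τ v = u, w v) / 2

/-- `pullback` is the adjoint of one averaging round, which moves the round from the values to the
weights. -/
theorem sum_pullback_mul {n : ℕ} (τ : Fin n → Fin n) (w f : Fin n → ℝ) :
    ∑ u, pullback τ w u * f u = ∑ v, w v * ((f v + f (τ v)) / 2) := by
  have : ∑ v, w v * f (τ v) = ∑ u, (∑ v with τ v = u, w v) * f u := by
    rw [← Finset.sum_fiberwise (s := Finset.univ) (g := τ)]
    refine Finset.sum_congr rfl fun u _ => ?_
    rw [Finset.sum_mul]
    refine Finset.sum_congr rfl fun v hv => ?_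
    rw [(Finset.mem_filter.1 hv).2]
  calc _ = (∑ u, w u * f u + ∑ u, (∑ v with τ v = u, w v) * f u) / 2 := by
        rw [← Finset.sum_add_distrib, Finset.sum_div]
        exact Finset.sum_congr rfl fun u _ => by unfold pullback; ring
    _ = _ := by
        rw [← this, ← Finset.sum_add_distrib, Finset.sum_div]
        exact Finset.sum_congr rfl fun u _ => by ring

/-- The number of elements of `R` whose image hits `S` or a previous image. -/
def collisions {n : ℕ} (τ : Fin n → Fin n) (S R : Finset (Fin n)) : ℕ :=
  S.card + R.card - (S ∪ R.image τ).card

theorem card_union_image_add_collisions {n : ℕ} (τ : Fin n → Fin n) (S R : Finset (Fin n)) :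
    (S ∪ R.image τ).card + collisions τ S R = S.card + R.card := by
  have h1 := Finset.card_union_le S (R.image τ)
  have h2 := Finset.card_image_le (s := R) (f := τ)
  unfold collisions
  omega

theorem pullback_le {n : ℕ} (τ : Fin n → Fin n) {w : Fin n → ℝ} {b : ℝ} {S : Finset (Fin n)}
    (hb : 0 ≤ b) (hw : ∀ v, w v ≤ b) (hS : ∀ v ∉ S, w v = 0) (u : Fin n) :
    pullback τ w u ≤ 2 ^ collisions τ S S * (b / 2) := by
  have h1 : w u ≤ (if u ∈ S then 1 else 0 : ℕ) * b := by
    split_ifs with h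
    · simpa using hw u
    · simp [hS u h]
  have h2 : ∑ v with τ v = u, w v ≤ ((S.filter fun v => τ v = u).card : ℝ) * b := by
    rw [← nsmul_eq_mul]
    calc _ = ∑ v ∈ S.filter (fun v => τ v = u), w v := by
          symm
          apply Finset.sum_subset
          · intro v; simp
          · intro v hv hv'
            apply hS
            simp at hv hv'
            exact fun h => hv' h hv
      _ ≤ _ := Finset.sum_le_card_nsmul _ _ _ fun v _ => hw v
  -- Every piece of weight that lands on `u` after the first is a collision.
  have h3 : (if u ∈ S then 1 else 0) + (S.filter fun v => τ v = u).card
      ≤ 1 + collisions τ S S := by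
    have hc := card_union_image_add_collisions τ S S
    have hsub : S ∪ S.image τ ⊆
        insert u (S.erase u ∪ (S.filter fun v => ¬ τ v = u).image τ) := by
      intro y
      simp only [Finset.mem_union, Finset.mem_image, Finset.mem_insert, Finset.mem_erase,
        Finset.mem_filter]
      rintro (h | ⟨v, hv, rfl⟩)
      · tauto
      · by_cases h : τ v = u
        · exact Or.inl h
        · exact Or.inr (Or.inr ⟨v, ⟨hv, h⟩, rfl⟩)
    have h4 := Finset.card_le_card hsub
    have h5 := Finset.card_insert_le u (S.erase u ∪ (S.filter fun v => ¬ τ v = u).image τ)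
    have h6 := Finset.card_union_le (S.erase u) ((S.filter fun v => ¬ τ v = u).image τ)
    have h7 := Finset.card_image_le (s := S.filter fun v => ¬ τ v = u) (f := τ)
    have h8 := Finset.card_filter_add_card_filter_not (s := S) (fun v => τ v = u)
    split_ifs with h
    · have := Finset.card_erase_add_one h
      omega
    · rw [Finset.erase_eq_of_notMem h] at *
      omega
  -- The cruder power of two makes the bounds of successive rounds multiply, so that only the total
  -- number of collisions matters.
  have h9 : 1 + collisions τ S S ≤ 2 ^ collisions τ S S := by
    have := Nat.lt_two_pow_self (n := collisions τ S S)
    omega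
  have h10 : (((if u ∈ S then 1 else 0) + (S.filter fun v => τ v = u).card : ℕ) : ℝ)
      ≤ 2 ^ collisions τ S S := by exact_mod_cast h3.trans h9
  push_cast at h10 h1
  unfold pullback
  have := mul_le_mul_of_nonneg_right h10 hb
  linarith

/-! ### Exponential moment of the number of collisions -/

theorem expect_snoc {X : Type*} [Fintype X] (T : ℕ) (f : (Fin (T + 1) → X) → ℝ) :
    𝔼 t, f t = 𝔼 a : X, 𝔼 t : Fin T → X, f (Fin.snoc t a) := by
  have := Finset.expect_product' (Finset.univ : Finset X) (Finset.univ : Finset (Fin T → X))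
    fun a t => f (Fin.snoc t a)
  rw [← this, Finset.univ_product_univ]
  exact (Fintype.expect_equiv (Fin.snocEquiv fun _ => X) _ _ fun _ => rfl).symm

/-- Resampling one coordinate preserves the uniform law: exchanging it with an independent copy is
an involution. -/
theorem expect_update {ι κ : Type*} [Fintype ι] [DecidableEq ι] [Fintype κ] [Nonempty κ]
    (a : ι) (F : (ι → κ) → ℝ) :
    𝔼 τ, F τ = 𝔼 τ : ι → κ, 𝔼 y, F (Function.update τ a y) := by
  let e : (ι → κ) × κ → (ι → κ) × κ := fun q => (Function.update q.1 a q.2, q.1 a)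
  have he : Function.Involutive e := by
    rintro ⟨τ, y⟩
    simp [e]
  calc 𝔼 τ, F τ = 𝔼 τ : ι → κ, 𝔼 _y : κ, F τ := by simp
    _ = 𝔼 q : (ι → κ) × κ, F q.1 := by
      rw [← Finset.expect_product', Finset.univ_product_univ]
    _ = 𝔼 q : (ι → κ) × κ, F (e q).1 :=
      (Fintype.expect_equiv he.toPerm _ _ fun _ => rfl).symm
    _ = _ := by
      rw [← Finset.expect_product', Finset.univ_product_univ]

theorem expect_prod_apply {ι κ : Type*} [Fintype ι] [DecidableEq ι] [Fintype κ]
    (f : ι → κ → ℝ) : 𝔼 τ : ι → κ, ∏ i, f i (τ i) = ∏ i, 𝔼 y, f i y := by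
  simp only [Fintype.expect_eq_sum_div_card]
  rw [Finset.prod_div_distrib, Finset.prod_univ_sum, Fintype.piFinset_univ]
  simp

theorem collisions_update_insert {n : ℕ} (τ : Fin n → Fin n) (S : Finset (Fin n))
    {R : Finset (Fin n)} {a : Fin n} (ha : a ∉ R) (y : Fin n) :
    collisions (Function.update τ a y) S (insert a R) =
      collisions τ S R + if y ∈ S ∪ R.image τ then 1 else 0 := by
  have h1 := card_union_image_add_collisions τ S R
  have h2 := card_union_image_add_collisions (Function.update τ a y) S (insert a R)
  have h3 : S ∪ (insert a R).image (Function.update τ a y) = insert y (S ∪ R.image τ) := by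
    rw [Finset.image_insert, Function.update_self, Finset.union_insert]
    congr 2
    refine Finset.image_congr fun v hv => ?_
    exact Function.update_of_ne (ne_of_mem_of_not_mem (Finset.mem_coe.1 hv) ha) _ _
  rw [h3, Finset.card_insert_of_notMem ha] at h2
  split_ifs with h
  · rw [Finset.insert_eq_of_mem h] at h2
    omega
  · rw [Finset.card_insert_of_notMem h] at h2
    omega

/-- The contacts of `R` are revealed one at a time. Each hits the set occupied so far, of size at
most `2 * S.card`, with probability at most `2 * S.card / n`, whatever the others are. -/
theorem expect_pow_collisions_le {n : ℕ} [NeZero n] {β : ℝ} (hβ : 1 ≤ β) (S : Finset (Fin n)) :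
    ∀ R ⊆ S, 𝔼 τ, β ^ collisions τ S R ≤ (1 + β * (2 * S.card / n)) ^ R.card := by
  have hn : (0 : ℝ) < n := by exact_mod_cast NeZero.pos n
  intro R
  induction R using Finset.induction_on with
  | empty => intro _; simp [collisions]
  | insert a R ha ih =>
    intro hR
    have hRS : R ⊆ S := (Finset.subset_insert a R).trans hR
    rw [expect_update a, Finset.card_insert_of_notMem ha, pow_succ]
    refine le_trans ?_ (mul_le_mul_of_nonneg_right (ih hRS) (by positivity))
    rw [Finset.expect_mul]
    refine Finset.expect_le_expect fun τ _ => ?_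
    simp only [collisions_update_insert τ S ha, pow_add]
    rw [← Finset.mul_expect]
    refine mul_le_mul_of_nonneg_left ?_ (by positivity)
    calc 𝔼 y, β ^ (if y ∈ S ∪ R.image τ then 1 else 0)
        ≤ 𝔼 y : Fin n, (1 + β * if y ∈ S ∪ R.image τ then 1 else 0) := by
          refine Finset.expect_le_expect fun y _ => ?_
          split_ifs <;> simp
      _ = 1 + β * ((S ∪ R.image τ).card / n) := by
          rw [Finset.expect_add_distrib, ← Finset.mul_expect, Fintype.expect_const,
            Fintype.expect_eq_sum_div_card, Finset.sum_boole, Fintype.card_fin,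
            Finset.filter_univ_mem]
      _ ≤ _ := by
          have h1 := Finset.card_union_le S (R.image τ)
          have h2 := Finset.card_image_le (s := R) (f := τ)
          have h3 := Finset.card_le_card hRS
          have h4 : ((S ∪ R.image τ).card : ℝ) ≤ 2 * S.card := by
            have : (S ∪ R.image τ).card ≤ 2 * S.card := by omega
            exact_mod_cast this
          gcongr

theorem expect_pow_collisions_le_exp {n : ℕ} [NeZero n] {β : ℝ} (hβ : 1 ≤ β)
    (S : Finset (Fin n)) :
    𝔼 τ, β ^ collisions τ S S ≤ Real.exp (2 * β / n * (S.card : ℝ) ^ 2) := by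
  refine (expect_pow_collisions_le hβ S S subset_rfl).trans ?_
  have : 1 + β * (2 * S.card / n) ≤ Real.exp (β * (2 * S.card / n)) := by
    rw [add_comm]; exact Real.add_one_le_exp _
  refine (pow_le_pow_left₀ (by positivity) this _).trans (le_of_eq ?_)
  rw [← Real.exp_nat_mul]
  congr 1
  ring

/-! ### Uniform probability -/

open Classical in
/-- The probability of `P` under the uniform distribution. -/
noncomputable def prob {Ω : Type*} [Fintype Ω] (P : Ω → Prop) : ℝ :=
  𝔼 ω, if P ω then 1 else 0

theorem prob_le_one {Ω : Type*} [Fintype Ω] [Nonempty Ω] (P : Ω → Prop) : prob P ≤ 1 := by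
  classical
  unfold prob
  calc _ ≤ 𝔼 _ω : Ω, (1 : ℝ) := Finset.expect_le_expect fun ω _ => by split_ifs <;> simp
    _ = 1 := Fintype.expect_const _

theorem prob_le_expect {Ω : Type*} [Fintype Ω] {P : Ω → Prop} {f : Ω → ℝ} (h0 : ∀ ω, 0 ≤ f ω)
    (h1 : ∀ ω, P ω → 1 ≤ f ω) : prob P ≤ 𝔼 ω, f ω :=
  Finset.expect_le_expect fun ω _ => by
    split_ifs with h
    · exact h1 ω h
    · exact h0 ω

theorem prob_mono {Ω : Type*} [Fintype Ω] {P R : Ω → Prop} (h : ∀ ω, P ω → R ω) :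
    prob P ≤ prob R := by
  refine prob_le_expect (fun ω => ?_) fun ω hω => ?_
  · split_ifs <;> simp
  · simp [h ω hω]

theorem prob_or_le {Ω : Type*} [Fintype Ω] (P R : Ω → Prop) :
    prob (fun ω => P ω ∨ R ω) ≤ prob P + prob R := by
  unfold prob
  rw [← Finset.expect_add_distrib]
  refine Finset.expect_le_expect fun ω _ => ?_
  by_cases h : P ω <;> by_cases h' : R ω <;> simp [h, h']

theorem prob_exists_le {Ω ι : Type*} [Fintype Ω] [Fintype ι] (P : ι → Ω → Prop) :
    prob (fun ω => ∃ i, P i ω) ≤ ∑ i, prob (P i) := by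
  unfold prob
  rw [← Finset.expect_sum_comm]
  refine Finset.expect_le_expect fun ω _ => ?_
  split_ifs with h
  · obtain ⟨i, hi⟩ := h
    refine le_trans ?_ (Finset.single_le_sum (fun j _ => ?_) (Finset.mem_univ i))
    · simp [hi]
    · split_ifs <;> simp
  · exact Finset.sum_nonneg fun j _ => by split_ifs <;> simp

theorem prob_snoc {X : Type*} [Fintype X] (T : ℕ) (P : (Fin (T + 1) → X) → Prop) :
    prob P = 𝔼 a : X, prob fun t : Fin T → X => P (Fin.snoc t a) :=
  expect_snoc T _

theorem contactLaw_real {n : ℕ} [NeZero n] (T : ℕ) (P : (Fin (T + 1) → Fin n → Fin n) → Prop) :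
    (contactLaw n T).real {t | P t} = 1 - prob fun t => ¬ P t := by
  classical
  have h1 : (contactLaw n T).real {t | P t} = prob P := by
    unfold contactLaw prob
    rw [MeasureTheory.measureReal_def, ProbabilityTheory.uniformOn_univ,
      Fintype.expect_eq_sum_div_card, Finset.sum_boole, MeasureTheory.Measure.count_apply
      (Set.toFinite _).measurableSet, Set.encard_eq_coe_toFinset_card, ENNReal.toReal_div]
    simp
  have h2 : prob P + prob (fun t => ¬ P t) = 1 := by
    unfold prob
    rw [← Finset.expect_add_distrib]
    calc _ = 𝔼 _t : Fin (T + 1) → Fin n → Fin n, (1 : ℝ) :=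
          Finset.expect_congr rfl fun t _ => by by_cases h : P t <;> simp [h]
      _ = 1 := Fintype.expect_const _
  linarith

/-! ### Concentration of the averages -/

/-- A Chernoff bound for weighted sums of independent centred variables. -/
theorem prob_le_sum_mul_le {n : ℕ} [NeZero n] {g w : Fin n → ℝ} {b δ : ℝ} (hb : 0 < b)
    (hw0 : ∀ v, 0 ≤ w v) (hwb : ∀ v, w v ≤ b) (hw1 : ∑ v, w v = 1) (hg : ∀ u, |g u| ≤ 1)
    (hg0 : ∑ u, g u = 0) (hδ0 : 0 ≤ δ) (hδ1 : δ ≤ 1) :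
    prob (fun τ : Fin n → Fin n => δ ≤ ∑ v, w v * g (τ v)) ≤ Real.exp (-(δ ^ 2 / (4 * b))) := by
  have hmgf : ∀ c, 0 ≤ c → c ≤ 1 → 𝔼 u, Real.exp (c * g u) ≤ Real.exp (c ^ 2) := by
    intro c hc0 hc1
    calc 𝔼 u, Real.exp (c * g u) ≤ 𝔼 u : Fin n, (c * g u + (1 + c ^ 2)) := by
          refine Finset.expect_le_expect fun u _ => ?_
          have h1 : |c * g u| ≤ c := by
            rw [abs_mul, abs_of_nonneg hc0]
            exact mul_le_of_le_one_right hc0 (hg u)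
          have h2 := Real.abs_exp_sub_one_sub_id_le (h1.trans hc1)
          have h3 := sq_le_sq' (abs_le.1 h1).1 (abs_le.1 h1).2
          have h4 := (abs_le.1 h2).2
          linarith
      _ = c ^ 2 + 1 := by
          rw [Finset.expect_add_distrib, ← Finset.mul_expect, Fintype.expect_const,
            Fintype.expect_eq_sum_div_card g, hg0]
          ring
      _ ≤ _ := Real.add_one_le_exp _
  -- This minimises the exponent `-l * δ + l ^ 2 * b`.
  set l := δ / (2 * b) with hl
  have hl0 : 0 ≤ l := by positivity
  have hlb : l * b = δ / 2 := by rw [hl]; field_simp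
  have hlw : ∀ v, l * w v ≤ δ / 2 := fun v => by
    rw [← hlb]; exact mul_le_mul_of_nonneg_left (hwb v) hl0
  calc _ ≤ 𝔼 τ : Fin n → Fin n, Real.exp (-(l * δ)) * ∏ v, Real.exp (l * w v * g (τ v)) := by
        refine prob_le_expect (fun τ => by positivity) fun τ hτ => ?_
        rw [← Real.exp_sum, ← Real.exp_add, Real.one_le_exp_iff]
        have : ∑ v, l * w v * g (τ v) = l * ∑ v, w v * g (τ v) := by
          rw [Finset.mul_sum]
          exact Finset.sum_congr rfl fun v _ => by ring
        rw [this]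
        have := mul_le_mul_of_nonneg_left hτ hl0
        linarith
    _ = Real.exp (-(l * δ)) * ∏ v, 𝔼 u, Real.exp (l * w v * g u) := by
        rw [← Finset.mul_expect, expect_prod_apply fun v u => Real.exp (l * w v * g u)]
    _ ≤ Real.exp (-(l * δ)) * ∏ v, Real.exp (l * (δ / 2) * w v) := by
        refine mul_le_mul_of_nonneg_left ?_ (by positivity)
        refine Finset.prod_le_prod (fun v _ => Finset.expect_nonneg fun u _ => by positivity)
          fun v _ => ?_
        refine (hmgf _ (mul_nonneg hl0 (hw0 v)) (by linarith [hlw v])).trans ?_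
        rw [Real.exp_le_exp]
        have := mul_le_mul_of_nonneg_left (hlw v) (mul_nonneg hl0 (hw0 v))
        nlinarith
    _ = Real.exp (-(δ ^ 2 / (4 * b))) := by
        rw [← Real.exp_sum, ← Finset.mul_sum, hw1, ← Real.exp_add]
        congr 1
        rw [hl]
        field_simp
        ring

theorem sum_mul_average_snoc {n T : ℕ} (w g : Fin n → ℝ) (t : Fin (T + 1) → Fin n → Fin n)
    (τ : Fin n → Fin n) :
    ∑ v, w v * average g (T + 1) (Fin.snoc t τ) v = ∑ v, pullback τ w v * average g T t v := by
  rw [sum_pullback_mul]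
  simp [average]

/-- Here `m` is the remaining collision budget. A last round with `j ≤ m` collisions replaces `m` by
`m - j` and `b` by `2 ^ j * (b / 2)`, which leaves the Chernoff term unchanged. The factor `β ^ j`
it adds to the other term is averaged by the moment bound. Since supports at most double, the
exponents sum to the geometric series `(4 ^ T - 1) / 3`. -/
theorem prob_le_sum_mul_average_le {n : ℕ} [NeZero n] {g : Fin n → ℝ} {β δ : ℝ} (hβ : 1 ≤ β)
    (hg : ∀ u, |g u| ≤ 1) (hg0 : ∑ u, g u = 0) (hδ0 : 0 ≤ δ) (hδ1 : δ ≤ 1) (T : ℕ) :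
    ∀ (m : ℕ) (S : Finset (Fin n)) (w : Fin n → ℝ) (b : ℝ), 0 < b → (∀ v, 0 ≤ w v) →
      (∀ v, w v ≤ b) → ∑ v, w v = 1 → (∀ v ∉ S, w v = 0) →
      prob (fun t : Fin (T + 1) → Fin n → Fin n => δ ≤ ∑ v, w v * average g T t v) ≤
        Real.exp (-(δ ^ 2 * 2 ^ T / (4 * 2 ^ m * b))) +
          Real.exp (2 * β / n * ((4 ^ T - 1) / 3) * (S.card : ℝ) ^ 2) / β ^ m := by
  have hβ0 : 0 < β := zero_lt_one.trans_le hβ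
  induction T with
  | zero =>
    intro m S w b hb hw0 hwb hw1 hS
    have h1 : prob (fun t : Fin (0 + 1) → Fin n → Fin n => δ ≤ ∑ v, w v * average g 0 t v)
        ≤ Real.exp (-(δ ^ 2 / (4 * b))) := by
      rw [prob_snoc]
      refine le_trans (le_of_eq ?_) (prob_le_sum_mul_le hb hw0 hwb hw1 hg hg0 hδ0 hδ1)
      refine Finset.expect_congr rfl fun τ _ => ?_
      unfold prob
      simp [average, Fin.snoc]
    refine h1.trans (le_add_of_le_of_nonneg ?_ (by positivity))
    rw [Real.exp_le_exp, neg_le_neg_iff, pow_zero, mul_one]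
    have : (1 : ℝ) ≤ 2 ^ m := one_le_pow₀ (by norm_num)
    refine div_le_div_of_nonneg_left (by positivity) (by positivity) ?_
    nlinarith
  | succ T ih =>
    intro m S w b hb hw0 hwb hw1 hS
    set E := Real.exp (-(δ ^ 2 * 2 ^ (T + 1) / (4 * 2 ^ m * b))) with hE
    set K := Real.exp (2 * β / n * ((4 ^ T - 1) / 3) * (4 * (S.card : ℝ) ^ 2)) with hK
    have h4 : (0 : ℝ) ≤ 4 ^ T - 1 := sub_nonneg.2 (one_le_pow₀ (by norm_num))
    have hK1 : 1 ≤ K := Real.one_le_exp (by positivity)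
    rw [prob_snoc]
    have step : ∀ τ : Fin n → Fin n,
        prob (fun t : Fin (T + 1) → Fin n → Fin n =>
          δ ≤ ∑ v, w v * average g (T + 1) (Fin.snoc t τ) v)
          ≤ E + K / β ^ m * β ^ collisions τ S S := by
      intro τ
      simp only [sum_mul_average_snoc]
      rcases le_or_gt (collisions τ S S) m with hj | hj
      · have hb' : 0 < 2 ^ collisions τ S S * (b / 2) := by positivity
        have hsum : ∑ v, pullback τ w v = 1 := by
          have := sum_pullback_mul τ w fun _ => 1
          simpa [hw1] using this
        refine (ih (m - collisions τ S S) (S ∪ S.image τ) (pullback τ w) _ hb' (fun v => ?_)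
          (pullback_le τ hb.le hwb hS) hsum (fun v hv => ?_)).trans (add_le_add ?_ ?_)
        · exact div_nonneg (add_nonneg (hw0 v) (Finset.sum_nonneg fun u _ => hw0 u)) zero_le_two
        · simp only [Finset.mem_union, Finset.mem_image, not_or, not_exists, not_and] at hv
          rw [pullback, hS v hv.1, Finset.sum_eq_zero, add_zero, zero_div]
          intro u hu
          exact hS u fun h => hv.2 u h (Finset.mem_filter.1 hu).2
        · rw [hE, ← Nat.sub_add_cancel hj, pow_add, Nat.add_sub_cancel]
          refine le_of_eq ?_
          congr 2
          field_simp
          ring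
        · have e1 : K / β ^ m * β ^ collisions τ S S = K / β ^ (m - collisions τ S S) := by
            rw [← Nat.sub_add_cancel hj, pow_add, Nat.add_sub_cancel]
            field_simp
          rw [e1, hK]
          have h1 := Finset.card_union_le S (S.image τ)
          have h2 := Finset.card_image_le (s := S) (f := τ)
          have h3 : ((S ∪ S.image τ).card : ℝ) ≤ 2 * S.card := by
            have : (S ∪ S.image τ).card ≤ 2 * S.card := by omega
            exact_mod_cast this
          have h5 : ((S ∪ S.image τ).card : ℝ) ^ 2 ≤ 4 * (S.card : ℝ) ^ 2 := by
            calc _ ≤ (2 * (S.card : ℝ)) ^ 2 := by gcongr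
              _ = _ := by ring
          gcongr
      -- The budget is exceeded, and the collision term alone is already at least one.
      · refine (prob_le_one _).trans ?_
        have h1 : β ^ m ≤ β ^ collisions τ S S := pow_le_pow_right₀ hβ hj.le
        have h2 : 1 ≤ K / β ^ m * β ^ collisions τ S S := by
          rw [div_mul_eq_mul_div, one_le_div (by positivity)]
          calc β ^ m = 1 * β ^ m := (one_mul _).symm
            _ ≤ K * β ^ collisions τ S S := by gcongr
        have : 0 < E := Real.exp_pos _
        linarith
    refine (Finset.expect_le_expect fun τ _ => step τ).trans ?_
    rw [Finset.expect_add_distrib, Fintype.expect_const, ← Finset.mul_expect]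
    refine add_le_add le_rfl ?_
    refine (mul_le_mul_of_nonneg_left (expect_pow_collisions_le_exp hβ S) (by positivity)).trans
      (le_of_eq ?_)
    rw [div_mul_eq_mul_div, hK, ← Real.exp_add]
    congr 2
    ring

theorem abs_average_le_of_init {n T : ℕ} {g : Fin n → ℝ} {δ : ℝ}
    (t : Fin (T + 1 + 1) → Fin n → Fin n) (h : ∀ v, |average g T (Fin.init t) v| ≤ δ) (v : Fin n) :
    |average g (T + 1) t v| ≤ δ := by
  have h1 := abs_le.1 (h v)
  have h2 := abs_le.1 (h (t (Fin.last (T + 1)) v))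
  rw [average, abs_le]
  constructor <;> linarith

/-- The averages of all nodes stay in an interval once they are in it. -/
theorem prob_exists_lt_abs_average_antitone {n : ℕ} [NeZero n] (g : Fin n → ℝ) (δ : ℝ) :
    Antitone fun T => prob fun t : Fin (T + 1) → Fin n → Fin n => ∃ v, δ < |average g T t v| := by
  refine antitone_nat_of_succ_le fun T => ?_
  rw [prob_snoc]
  refine (Finset.expect_le_expect fun τ _ => prob_mono (R := fun t => ∃ v, δ < |average g T t v|)
    fun t => ?_).trans (le_of_eq (Fintype.expect_const _))
  contrapose!
  intro h
  exact abs_average_le_of_init _ (by simpa using h)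

theorem prob_exists_lt_abs_average_le {n : ℕ} [NeZero n] {g : Fin n → ℝ} {β δ : ℝ} (hβ : 1 ≤ β)
    (hg : ∀ u, |g u| ≤ 1) (hg0 : ∑ u, g u = 0) (hδ0 : 0 ≤ δ) (hδ1 : δ ≤ 1) (T m : ℕ) :
    prob (fun t : Fin (T + 1) → Fin n → Fin n => ∃ v, δ < |average g T t v|) ≤
      2 * n * (Real.exp (-(δ ^ 2 * 2 ^ T / (4 * 2 ^ m))) +
        Real.exp (2 * β / n * ((4 ^ T - 1) / 3)) / β ^ m) := by
  have key : ∀ h : Fin n → ℝ, (∀ u, |h u| ≤ 1) → ∑ u, h u = 0 → ∀ v,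
      prob (fun t : Fin (T + 1) → Fin n → Fin n => δ ≤ average h T t v) ≤
      Real.exp (-(δ ^ 2 * 2 ^ T / (4 * 2 ^ m))) +
        Real.exp (2 * β / n * ((4 ^ T - 1) / 3)) / β ^ m := by
    intro h hh hh0 v
    have := prob_le_sum_mul_average_le hβ hh hh0 hδ0 hδ1 T m {v} (Pi.single v 1) 1 one_pos
      (fun u => by by_cases e : u = v <;> simp [e])
      (fun u => by by_cases e : u = v <;> simp [e])
      (by simp) (fun u hu => by simp at hu; simp [hu])
    simpa [Pi.single_apply] using this
  have h1 : ∀ v, prob (fun t : Fin (T + 1) → Fin n → Fin n => δ < |average g T t v|) ≤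
      2 * (Real.exp (-(δ ^ 2 * 2 ^ T / (4 * 2 ^ m))) +
        Real.exp (2 * β / n * ((4 ^ T - 1) / 3)) / β ^ m) := by
    intro v
    have a1 := key g hg hg0 v
    have a2 := key (fun u => - g u) (by simpa using hg) (by simp [hg0]) v
    refine (prob_mono (R := fun t => δ ≤ average g T t v ∨ δ ≤ average (fun u => - g u) T t v)
      fun t ht => ?_).trans ((prob_or_le _ _).trans (by linarith))
    rw [average_neg]
    rcases lt_abs.1 ht with h | h
    · exact Or.inl h.le
    · exact Or.inr h.le
  refine (prob_exists_le _).trans ((Finset.sum_le_sum fun v _ => h1 v).trans (le_of_eq ?_))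
  simp
  ring

/-! ### From averages back to buffers -/

/-- The deviation of the indicator of `p` from the fraction of nodes whose value satisfies `p`. -/
noncomputable def centredIndicator {α : Type*} {n : ℕ} (x : Fin n → α) (p : α → Prop)
    [DecidablePred p] (u : Fin n) : ℝ :=
  (if p (x u) then 1 else 0) - fraction p (allValues x)

theorem sum_centredIndicator {α : Type*} {n : ℕ} [NeZero n] (x : Fin n → α) (p : α → Prop)
    [DecidablePred p] : ∑ u, centredIndicator x p u = 0 := by
  have hn : (n : ℝ) ≠ 0 := by exact_mod_cast NeZero.ne n
  simp only [centredIndicator]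
  rw [Finset.sum_sub_distrib, fraction_allValues, Finset.sum_const, Finset.card_fin, nsmul_eq_mul,
    mul_div_cancel₀ _ hn, sub_self]

theorem abs_centredIndicator_le_one {α : Type*} {n : ℕ} (x : Fin n → α) (p : α → Prop)
    [DecidablePred p] (u : Fin n) : |centredIndicator x p u| ≤ 1 := by
  have h0 : 0 ≤ fraction p (allValues x) := by unfold fraction; positivity
  have h1 : fraction p (allValues x) ≤ 1 := by
    unfold fraction
    exact div_le_one_of_le₀ (by exact_mod_cast Multiset.countP_le_card _ _) (by positivity)
  unfold centredIndicator
  rw [abs_le]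
  split_ifs <;> constructor <;> linarith

theorem abs_fraction_allValues_sub_fraction_buffer_le {α : Type*} [LinearOrder α] {n k : ℕ}
    (hk : 0 < k) (x : Fin n → α) (p : α → Prop) [DecidablePred p]
    (hp : ∀ a b, a ≤ b → p b → p a) {T : ℕ} {t : Fin (T + 1) → Fin n → Fin n} {v : Fin n} {δ : ℝ}
    (h : |average (centredIndicator x p) T t v| ≤ δ) :
    |fraction p (allValues x) - fraction p (buffer k x T t v)| ≤ δ + T / k := by
  have h1 := abs_fraction_buffer_sub_average_le hk x p hp T t v
  unfold centredIndicator at h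
  rw [average_sub_const] at h
  rw [abs_le] at h h1 ⊢
  constructor <;> linarith

/-! ### Choice of parameters -/

theorem exists_two_pow_between {a : ℝ} {T : ℕ} (hT : a ≤ 2 ^ T) :
    ∃ T₀ ≤ T, a ≤ 2 ^ T₀ ∧ (T₀ = 0 ∨ (2 : ℝ) ^ T₀ ≤ 2 * a) := by
  classical
  have hex : ∃ T₀ : ℕ, a ≤ 2 ^ T₀ := ⟨T, hT⟩
  refine ⟨Nat.find hex, Nat.find_min' hex hT, Nat.find_spec hex, ?_⟩
  rcases Nat.eq_zero_or_pos (Nat.find hex) with h | h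
  · exact Or.inl h
  · right
    have h1 := Nat.find_min hex (Nat.sub_lt h one_pos)
    rw [not_le] at h1
    calc (2 : ℝ) ^ Nat.find hex = 2 * 2 ^ (Nat.find hex - 1) := by
          rw [← pow_succ', Nat.sub_add_cancel h]
      _ ≤ 2 * a := by linarith

theorem eventually_log_le_mul_rpow {κ : ℝ} (hκ : 0 < κ) :
    ∀ᶠ n : ℕ in Filter.atTop, Real.log n ≤ κ * (n : ℝ) ^ (1 / 8 : ℝ) := by
  have h := (isLittleO_log_rpow_atTop (by norm_num : (0 : ℝ) < 1 / 8)).bound hκ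
  filter_upwards [tendsto_natCast_atTop_atTop.eventually h] with n hn
  rw [Real.norm_of_nonneg (Real.rpow_nonneg (Nat.cast_nonneg n) _)] at hn
  exact (le_abs_self _).trans hn

theorem prob_exists_half_lt_abs_average_le {c A c₀ ε : ℝ} {n m T : ℕ} [NeZero n] {g : Fin n → ℝ}
    (hg : ∀ u, |g u| ≤ 1) (hg0 : ∑ u, g u = 0) (hm : 2 * (c + 2) ≤ m)
    (hA0 : 0 < A) (hA : 2 ^ (m + 4) * (c + 2) ≤ A) (hc₀ : 0 < c₀)
    (hlog : Real.log n ≤ c₀ ^ 2 / (2 * A) * (n : ℝ) ^ (1 / 8 : ℝ))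
    (hε : c₀ * (n : ℝ) ^ (-(1 / 16) : ℝ) ≤ ε) (hε1 : ε ≤ 1)
    (hT : A * Real.log n / ε ^ 2 ≤ 2 ^ T) :
    prob (fun t : Fin (T + 1) → Fin n → Fin n => ∃ v, ε / 2 < |average g T t v|) ≤
      8 * (n : ℝ) ^ (-c - 1) := by
  have hn1 : (1 : ℝ) ≤ n := by exact_mod_cast NeZero.one_le
  have hn : (0 : ℝ) < n := by linarith
  have hε0 : 0 < ε := lt_of_lt_of_le (by positivity) hε
  have hlog0 : 0 ≤ Real.log n := Real.log_nonneg hn1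
  obtain ⟨T₀, hT₀, hlow, hup⟩ := exists_two_pow_between hT
  refine (prob_exists_lt_abs_average_antitone g (ε / 2) hT₀).trans ?_
  -- With `β = √n` and `4 ^ T₀ ≤ √n` the collision exponent stays bounded, while `β ^ m` is at least
  -- `n ^ (c + 2)`.
  refine (prob_exists_lt_abs_average_le (β := (n : ℝ) ^ (1 / 2 : ℝ))
    (Real.one_le_rpow hn1 (by norm_num)) hg hg0 (by positivity) (by linarith) T₀ m).trans ?_
  have h1 : Real.exp (-((ε / 2) ^ 2 * 2 ^ T₀ / (4 * 2 ^ m))) ≤ (n : ℝ) ^ (-(c + 2)) := by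
    rw [Real.rpow_def_of_pos hn, Real.exp_le_exp]
    have e1 : A * Real.log n ≤ 2 ^ T₀ * ε ^ 2 := (div_le_iff₀ (by positivity)).1 hlow
    -- The factor `2 ^ 4` in `A` pays for the squared half of `ε` and for the `4` of the Chernoff
    -- bound.
    have e2 : (c + 2) * Real.log n ≤ (ε / 2) ^ 2 * 2 ^ T₀ / (4 * 2 ^ m) := by
      rw [le_div_iff₀ (by positivity)]
      have e3 := mul_le_mul_of_nonneg_right hA hlog0
      rw [pow_add] at e3
      linarith
    linarith
  have h2 : 2 * (n : ℝ) ^ (1 / 2 : ℝ) / n * ((4 ^ T₀ - 1) / 3) ≤ 1 := by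
    rcases hup with h | h
    · simp [h]
    · have e1 : c₀ ^ 2 * (n : ℝ) ^ (-(1 / 8) : ℝ) ≤ ε ^ 2 := by
        calc _ = (c₀ * (n : ℝ) ^ (-(1 / 16) : ℝ)) ^ 2 := by
              rw [mul_pow, ← Real.rpow_natCast ((n : ℝ) ^ (-(1 / 16) : ℝ)), ← Real.rpow_mul hn.le]
              norm_num
          _ ≤ _ := by gcongr
      have e2 : (2 : ℝ) ^ T₀ ≤ (n : ℝ) ^ (1 / 4 : ℝ) := by
        refine h.trans ?_
        rw [mul_div_assoc', div_le_iff₀ (by positivity)]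
        calc 2 * (A * Real.log n)
            ≤ 2 * (A * (c₀ ^ 2 / (2 * A) * (n : ℝ) ^ (1 / 8 : ℝ))) := by gcongr
          _ = c₀ ^ 2 * (n : ℝ) ^ (1 / 4 + -(1 / 8) : ℝ) := by
              norm_num
              field_simp
          _ = (n : ℝ) ^ (1 / 4 : ℝ) * (c₀ ^ 2 * (n : ℝ) ^ (-(1 / 8) : ℝ)) := by
              rw [Real.rpow_add hn]; ring
          _ ≤ _ := by gcongr
      have e3 : (4 : ℝ) ^ T₀ ≤ (n : ℝ) ^ (1 / 2 : ℝ) := by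
        calc (4 : ℝ) ^ T₀ = (2 ^ T₀) ^ 2 := by rw [← pow_mul, mul_comm, pow_mul]; norm_num
          _ ≤ ((n : ℝ) ^ (1 / 4 : ℝ)) ^ 2 := by gcongr
          _ = _ := by
              rw [← Real.rpow_natCast, ← Real.rpow_mul hn.le]
              norm_num
      have e4 : (n : ℝ) ^ (1 / 2 : ℝ) * (n : ℝ) ^ (1 / 2 : ℝ) = n := by
        rw [← Real.rpow_add hn]; norm_num
      calc _ ≤ 2 * (n : ℝ) ^ (1 / 2 : ℝ) / n * ((n : ℝ) ^ (1 / 2 : ℝ) / 3) := by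
            gcongr
            linarith
        _ = 2 * ((n : ℝ) ^ (1 / 2 : ℝ) * (n : ℝ) ^ (1 / 2 : ℝ)) / (n * 3) := by
            field_simp
        _ ≤ 1 := by
            rw [e4, div_le_one (by positivity)]
            linarith
  have h3 : Real.exp (2 * (n : ℝ) ^ (1 / 2 : ℝ) / n * ((4 ^ T₀ - 1) / 3)) ≤ 3 :=
    (Real.exp_le_exp.2 h2).trans (by linarith [Real.exp_one_lt_d9])
  have h4 : (n : ℝ) ^ (c + 2) ≤ ((n : ℝ) ^ (1 / 2 : ℝ)) ^ m := by
    rw [← Real.rpow_natCast, ← Real.rpow_mul hn.le]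
    exact Real.rpow_le_rpow_of_exponent_le hn1 (by linarith)
  have h5 : Real.exp (2 * (n : ℝ) ^ (1 / 2 : ℝ) / n * ((4 ^ T₀ - 1) / 3)) /
      ((n : ℝ) ^ (1 / 2 : ℝ)) ^ m ≤ 3 * (n : ℝ) ^ (-(c + 2)) := by
    rw [Real.rpow_neg hn.le, ← div_eq_mul_inv]
    gcongr
  calc _ ≤ 2 * n * ((n : ℝ) ^ (-(c + 2)) + 3 * (n : ℝ) ^ (-(c + 2))) := by gcongr
    _ = 8 * ((n : ℝ) ^ (1 : ℝ) * (n : ℝ) ^ (-(c + 2))) := by rw [Real.rpow_one]; ring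
    _ = _ := by
      rw [← Real.rpow_add hn]
      congr 2
      ring

end Gossip

theorem mainTheorem7 (c : ℝ) (hc : 0 < c) :
    ∃ A : ℝ, 0 < A ∧ ∀ C : ℝ, 0 < C →
    ∃ B₁ : ℝ, 0 < B₁ ∧ ∀ B₂ : ℝ, B₁ ≤ B₂ → ∀ c₀ : ℝ, 0 < c₀ →
    ∃ n₀ : ℕ, ∀ n : ℕ, n₀ ≤ n → ∀ ε : ℝ, c₀ * (n : ℝ) ^ (-(1 / 16) : ℝ) ≤ ε → ε < 1 →
    ∀ T : ℕ, A * Real.log n / ε ^ 2 ≤ (2 : ℝ) ^ T → (T : ℝ) ≤ C * Gossip.logScale n ε →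
    ∀ k : ℕ, B₁ * (1 / ε * Gossip.logScale n ε) ≤ (k : ℝ) →
      (k : ℝ) ≤ B₂ * (1 / ε * Gossip.logScale n ε) →
    ∀ (α : Type*) [LinearOrder α] (x : Fin n → α) (z : α),
      1 - (n : ℝ) ^ (-c) ≤
        (Gossip.contactLaw n T).real
          {t | ∀ v : Fin n,
            |Gossip.quantileLT (Gossip.allValues x) z -
                Gossip.quantileLT (Gossip.buffer k x T t v) z| ≤ ε ∧
            |Gossip.quantileLE (Gossip.allValues x) z -
                Gossip.quantileLE (Gossip.buffer k x T t v) z| ≤ ε} := by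
  obtain ⟨m, hm⟩ := exists_nat_ge (2 * (c + 2))
  have hA0 : 0 < 2 ^ (m + 4) * (c + 2) := by positivity
  -- `B₁ = 2 * C` makes the compaction error `T / k` at most `ε / 2`.
  refine ⟨2 ^ (m + 4) * (c + 2), hA0, fun C hC => ⟨2 * C, by positivity, fun B₂ _ c₀ hc₀ => ?_⟩⟩
  set A := 2 ^ (m + 4) * (c + 2) with hA
  -- The threshold `16` makes `log (log n)` positive and absorbs the final constant, `8` for each of
  -- the two quantile conventions.
  obtain ⟨n₀, hn₀⟩ := Filter.eventually_atTop.1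
    ((Gossip.eventually_log_le_mul_rpow (κ := c₀ ^ 2 / (2 * A)) (by positivity)).and
      (Filter.eventually_ge_atTop 16))
  refine ⟨n₀, fun n hn ε hε hε1 T hT hTC k hk _ α _ x z => ?_⟩
  obtain ⟨hlog, hn16⟩ := hn₀ n hn
  have : NeZero n := ⟨by omega⟩
  have hn16' : (16 : ℝ) ≤ n := by exact_mod_cast hn16
  have hnpos : (0 : ℝ) < n := by linarith
  have hε0 : 0 < ε := lt_of_lt_of_le (by positivity) hε
  have hscale : 0 < Gossip.logScale n ε := by
    have h1 : 1 < Real.log n := by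
      rw [Real.lt_log_iff_exp_lt hnpos]
      linarith [Real.exp_one_lt_d9]
    exact add_pos (Real.log_pos h1) (Real.log_pos ((one_lt_div hε0).2 hε1))
  have hk0' : (0 : ℝ) < k := lt_of_lt_of_le (by positivity) hk
  have hk0 : 0 < k := by exact_mod_cast hk0'
  have hTk : (T : ℝ) / k ≤ ε / 2 := by
    rw [div_le_iff₀ hk0']
    calc (T : ℝ) ≤ C * Gossip.logScale n ε := hTC
      _ = ε / 2 * (2 * C * (1 / ε * Gossip.logScale n ε)) := by field_simp
      _ ≤ _ := by gcongr
  have tail := fun (p : α → Prop) (_ : DecidablePred p) =>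
    Gossip.prob_exists_half_lt_abs_average_le (Gossip.abs_centredIndicator_le_one x p)
      (Gossip.sum_centredIndicator x p) hm hA0 hA.ge hc₀ hlog hε hε1.le hT
  rw [Gossip.contactLaw_real]
  refine sub_le_sub_left ?_ 1
  calc _ ≤ Gossip.prob fun t : Fin (T + 1) → Fin n → Fin n =>
        (∃ v, ε / 2 < |Gossip.average (Gossip.centredIndicator x (· < z)) T t v|) ∨
        ∃ v, ε / 2 < |Gossip.average (Gossip.centredIndicator x (· ≤ z)) T t v| := by
        refine Gossip.prob_mono fun t => ?_
        contrapose!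
        rintro ⟨h1, h2⟩ v
        exact ⟨(Gossip.abs_fraction_allValues_sub_fraction_buffer_le hk0 x (· < z)
            (fun _ _ => lt_of_le_of_lt) (h1 v)).trans (by linarith),
          (Gossip.abs_fraction_allValues_sub_fraction_buffer_le hk0 x (· ≤ z)
            (fun _ _ => le_trans) (h2 v)).trans (by linarith)⟩
    _ ≤ 8 * (n : ℝ) ^ (-c - 1) + 8 * (n : ℝ) ^ (-c - 1) :=
        (Gossip.prob_or_le _ _).trans (add_le_add (tail _ _) (tail _ _))
    _ = 16 / n * (n : ℝ) ^ (-c) := by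
        rw [Real.rpow_sub_one hnpos.ne']
        ring
    _ ≤ 1 * (n : ℝ) ^ (-c) := by
        gcongr
        rwa [div_le_one hnpos]
    _ = _ := one_mul _
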